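/- Let $\mathcal U$ be a finite dimensional complex Hilbert space, let $\mathbb D$ be the open unit disc and $\mathbb T$ the unit circle. For an operator $A$ on $\mathcal U$ put $\operatorname{Re}A=\tfrac12(A+A^*)$. Let $\mathfrak C(\mathcal U)$ be the Carathéodory class of holomorphic functions $F:\mathbb D\to\mathcal L(\mathcal U)$ with $\operatorname{Re}F(\lambda)\ge 0$ for all $\lambda\in\mathbb D$, and let $H^\infty(\mathcal U)$ be the set of bounded holomorphic functions $\mathbb D\to\mathcal L(\mathcal U)$. For $F,G\in\mathfrak C(\mathcal U)$ write $F\prec_{\mathfrak C}G$ if there is a function $Q$ on $\mathbb D$, with $\sup_{\lambda\in\mathbb D}\|Q(\lambda)\|<\infty$, such that for every $\lambda\in\mathbb D$ the value $Q(\lambda)$ is an operator on the support subspace $(\ker\operatorname{Re}G(\lambda))^\perp$ (which does not depend on $\lambda$) and $$F(\lambda)-G(\lambda)=(\operatorname{Re}G(\lambda))^{1/2}\,Q(\lambda)\,(\operatorname{Re}G(\lambda))^{1/2}.$$ Write $F\sim_{\mathfrak C}G$ if $F\prec_{\mathfrak C}G$ and $G\prec_{\mathfrak C}F$. Let $G\in\mathfrak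 C(\mathcal U)\cap H^\infty(\mathcal U)$ satisfy $\operatorname{Re}G=0$ a.e. on $\mathbb T$; that is, for almost every $\tau\in\mathbb T$ with respect to arc length, the nontangential limit $G(\tau)$ of $G$ at $\tau$ exists and $\operatorname{Re}G(\tau)=0$. Then the $\sim_{\mathfrak C}$-equivalence class of $G$ is a singleton, $\{F\in\mathfrak C(\mathcal U): F\sim_{\mathfrak C}G\}=\{G\}$. Moreover, if $F\in\mathfrak C(\mathcal U)$ and $F\prec_{\mathfrak C}G$, then $F=G$. -/

import Mathlib

noncomputable section

namespace Caratheodory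

open scoped ComplexStarModule

/-- The open unit disc of the complex plane. -/
abbrev Disc : Set ℂ := Metric.ball (0 : ℂ) 1

variable {U : Type*} [NormedAddCommGroup U] [InnerProductSpace ℂ U] [CompleteSpace U]

/-- The real part `Re A = (A + A*) / 2` of a bounded operator. -/
def reOp (A : U →L[ℂ] U) : U →L[ℂ] U := (ℜ A : U →L[ℂ] U)

/-- Positive real operators: bounded operators whose real part is a positive (semidefinite)
operator. -/
def IsPositiveReal (A : U →L[ℂ] U) : Prop := (reOp A).IsPositive

/-- The support subspace of `Re A`: the orthogonal complement of the kernel of `Re A`. -/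
def reSupport (A : U →L[ℂ] U) : Submodule ℂ U := (LinearMap.ker (reOp A).toLinearMap)ᗮ

instance (A : U →L[ℂ] U) : (reSupport A).HasOrthogonalProjection := by
  unfold reSupport; infer_instance

/-- The positive square root `(Re A)^{1/2}` of the real part of a positive real operator. -/
def sqrtRe (A : U →L[ℂ] U) : U →L[ℂ] U := CFC.sqrt (reOp A)

/-- An operator on a closed subspace `K`, viewed as an operator on the whole space
(zero on the orthogonal complement of `K`). -/
def onSubspace (K : Submodule ℂ U) [K.HasOrthogonalProjection] (X : K →L[ℂ] K) : U →L[ℂ] U :=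
  K.subtypeL ∘L X ∘L K.orthogonalProjectionOnto

/-- Holomorphic operator-valued functions on the open unit disc. -/
def IsHolomorphic (F : Disc → (U →L[ℂ] U)) : Prop :=
  ∃ f : ℂ → (U →L[ℂ] U), DifferentiableOn ℂ f Disc ∧ ∀ z : Disc, F z = f z

variable (U) in
/-- The Carathéodory class: holomorphic functions on the open unit disc whose values are
positive real operators. -/
def caratheodoryClass : Set (Disc → (U →L[ℂ] U)) :=
  {F | IsHolomorphic F ∧ ∀ z, IsPositiveReal (F z)}

variable (U) in
/-- `H^∞`: bounded holomorphic operator-valued functions on the open unit disc. -/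
def hInfty : Set (Disc → (U →L[ℂ] U)) :=
  {F | IsHolomorphic F ∧ ∃ C : ℝ, ∀ z, ‖F z‖ ≤ C}

/-- The pre-order: `F - G = (Re G)^{1/2} Q (Re G)^{1/2}` on the disc for a (norm-)bounded function
`Q` on the disc whose value at `z` is a bounded operator on the support subspace of `Re (G z)`
(for a Carathéodory function `G` this subspace does not depend on `z`). -/
def Prec (F G : Disc → (U →L[ℂ] U)) : Prop :=
  ∃ Q : (z : Disc) → (reSupport (G z) →L[ℂ] reSupport (G z)),
    (∃ C : ℝ, ∀ z, ‖Q z‖ ≤ C) ∧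
    ∀ z, F z - G z = sqrtRe (G z) ∘L onSubspace (reSupport (G z)) (Q z) ∘L sqrtRe (G z)

/-- The equivalence relation associated with the pre-order. -/
def Equivalent (F G : Disc → (U →L[ℂ] U)) : Prop := Prec F G ∧ Prec G F

/-- The nontangential approach region (Stolz region) with aperture `M` at a point `τ` of the unit
circle. -/
def stolzRegion (τ : ℂ) (M : ℝ) : Set ℂ := {z | ‖z‖ < 1 ∧ ‖τ - z‖ < M * (1 - ‖z‖)}

/-- `A` is the nontangential limit of `F` at the point `τ` of the unit circle: `F z → A` as `z → τ`
inside every Stolz region at `τ`. -/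
def HasNontangentialLimit (F : Disc → (U →L[ℂ] U)) (τ : ℂ) (A : U →L[ℂ] U) : Prop :=
  ∀ M : ℝ, Filter.Tendsto F
    (Filter.comap (Subtype.val : Disc → ℂ) (nhdsWithin τ (stolzRegion τ M))) (nhds A)

/-- `Re F = 0` almost everywhere (for arc length) on the unit circle, where the values of `F` on the
circle are its nontangential limits. -/
def ReVanishesAEOnCircle (F : Disc → (U →L[ℂ] U)) : Prop :=
  ∀ᵐ θ : ℝ ∂(MeasureTheory.volume.restrict (Set.Ioc 0 (2 * Real.pi))),
    ∃ A : U →L[ℂ] U, HasNontangentialLimit F (Complex.exp (θ * Complex.I)) A ∧ reOp A = 0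

end Caratheodory

end

/-!
Let `h = F - G`. The factorisation `F - G = (Re G)^{1/2} Q (Re G)^{1/2}` and the C⋆-identity
`‖(Re G)^{1/2}‖ ^ 2 = ‖Re G‖` give `‖h‖ ≤ C ‖Re G‖` on the disc (`Prec.exists_norm_sub_le`).
As `G` is bounded, so is `h`; as `Re G` has radial limit zero at almost every point of the circle,
so has `h`. A bounded holomorphic function on the disc whose radial limits vanish almost everywhere
is zero (`eq_zero_of_ae_tendsto_radial_zero`): let the radius tend to `1` in the Cauchy integral
formula and use dominated convergence. Hence `F = G`.
-/

open Filter Topology MeasureTheory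

namespace Caratheodory

/-- A bounded holomorphic function on the unit disc, with values in a Banach space, vanishes if its
radial limits vanish at almost every point of the unit circle. -/
theorem eq_zero_of_ae_tendsto_radial_zero {E : Type*} [NormedAddCommGroup E] [NormedSpace ℂ E]
    [CompleteSpace E] {h : ℂ → E} {C : ℝ} (hd : DifferentiableOn ℂ h Disc)
    (hC : ∀ z ∈ Disc, ‖h z‖ ≤ C)
    (hlim : ∀ᵐ θ : ℝ ∂(volume.restrict (Set.Ioc 0 (2 * Real.pi))),
      Tendsto (fun r : ℝ => h (circleMap 0 r θ)) (𝓝[<] 1) (𝓝 0))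
    {z : ℂ} (hz : z ∈ Disc) : h z = 0 := by
  have hz1 : ‖z‖ < 1 := by simpa using hz
  -- On circles of radius `r ∈ (ρ, 1)` the Cauchy kernel at `z` is bounded by `(ρ - ‖z‖)⁻¹`.
  obtain ⟨ρ, hzρ, hρ1⟩ := exists_between hz1
  have hρ0 : 0 < ρ := (norm_nonneg z).trans_lt hzρ
  have hC0 : 0 ≤ C := (norm_nonneg _).trans (hC z hz)
  have hev : ∀ᶠ r : ℝ in 𝓝[<] 1, ρ < r ∧ r < 1 :=
    (eventually_nhdsWithin_of_eventually_nhds (eventually_gt_nhds hρ1)).and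
      self_mem_nhdsWithin
  have hmem : ∀ {r θ : ℝ}, ρ < r → r < 1 → circleMap 0 r θ ∈ Disc := fun {r θ} h1 h2 => by
    simpa [abs_of_pos (hρ0.trans h1)] using h2
  have hsub : ∀ {r θ : ℝ}, ρ < r → ρ - ‖z‖ ≤ ‖circleMap 0 r θ - z‖ := fun {r θ} h1 => by
    have := norm_sub_norm_le (circleMap 0 r θ) z
    rw [norm_circleMap_zero, abs_of_pos (hρ0.trans h1)] at this
    linarith
  have hint : Tendsto (fun r : ℝ => ∮ w in C(0, r), (w - z)⁻¹ • h w) (𝓝[<] 1) (𝓝 0) := by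
    rw [show (0 : E) = ∫ _ in (0 : ℝ)..2 * Real.pi, (0 : E) by simp]
    refine intervalIntegral.tendsto_integral_filter_of_dominated_convergence
      (fun _ => (ρ - ‖z‖)⁻¹ * C) ?_ ?_ intervalIntegrable_const ?_
    · filter_upwards [hev] with r hr
      refine Continuous.aestronglyMeasurable ?_
      have hne : ∀ θ, circleMap 0 r θ - z ≠ 0 := fun θ h0 => by
        have := hsub (θ := θ) hr.1
        rw [h0, norm_zero] at this
        linarith
      have hcont : Continuous fun θ => h (circleMap 0 r θ) :=
        hd.continuousOn.comp_continuous (continuous_circleMap 0 r) fun θ => hmem hr.1 hr.2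
      simp only [deriv_circleMap]
      exact ((continuous_circleMap 0 r).mul continuous_const).smul
        ((((continuous_circleMap 0 r).sub continuous_const).inv₀ hne).smul hcont)
    · filter_upwards [hev] with r hr
      refine Eventually.of_forall fun θ _ => ?_
      have h1 : ‖deriv (circleMap 0 r) θ‖ ≤ 1 := by
        simpa [deriv_circleMap, abs_of_pos (hρ0.trans hr.1)] using hr.2.le
      have h2 : ‖(circleMap 0 r θ - z)⁻¹‖ ≤ (ρ - ‖z‖)⁻¹ := by
        rw [norm_inv]
        exact inv_anti₀ (sub_pos.2 hzρ) (hsub hr.1)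
      rw [norm_smul, norm_smul]
      calc _ ≤ 1 * ((ρ - ‖z‖)⁻¹ * C) := by
            gcongr
            exact hC _ (hmem hr.1 hr.2)
        _ = _ := one_mul _
    · rw [ae_restrict_iff' measurableSet_Ioc] at hlim
      filter_upwards [hlim] with θ hθ hmemθ
      rw [Set.uIoc_of_le (by positivity)] at hmemθ
      have hθ := hθ hmemθ
      have hc : Tendsto (fun r : ℝ => circleMap 0 r θ) (𝓝[<] 1) (𝓝 (circleMap 0 1 θ)) := by
        refine Tendsto.mono_left (Continuous.tendsto ?_ 1) nhdsWithin_le_nhds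
        unfold circleMap
        fun_prop
      have hne : circleMap 0 1 θ - z ≠ 0 := fun h0 => by
        have := hsub (r := 1) (θ := θ) hρ1
        rw [h0, norm_zero] at this
        linarith
      simp only [deriv_circleMap]
      simpa using (hc.mul_const Complex.I).smul (((hc.sub_const z).inv₀ hne).smul hθ)
  have hcauchy : (fun r : ℝ => ∮ w in C(0, r), (w - z)⁻¹ • h w) =ᶠ[𝓝[<] 1]
      fun _ => (2 * Real.pi * Complex.I : ℂ) • h z := by
    filter_upwards [hev] with r hr
    refine DifferentiableOn.circleIntegral_sub_inv_smul (hd.mono ?_) ?_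
    · exact Metric.closedBall_subset_ball hr.2
    · simpa using hzρ.trans hr.1
  have := tendsto_nhds_unique (tendsto_const_nhds.congr' hcauchy.symm) hint
  exact (smul_eq_zero.1 this).resolve_left Complex.two_pi_I_ne_zero

variable {U : Type*} [NormedAddCommGroup U] [InnerProductSpace ℂ U]

/-- A nontangential limit is in particular a radial limit. -/
theorem HasNontangentialLimit.tendsto_radial {F : Disc → (U →L[ℂ] U)} {f : ℂ → (U →L[ℂ] U)}
    (hf : ∀ z : Disc, F z = f z) {θ : ℝ} {A : U →L[ℂ] U}
    (h : HasNontangentialLimit F (Complex.exp (θ * Complex.I)) A) :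
    Tendsto (fun r : ℝ => f (circleMap 0 r θ)) (𝓝[<] 1) (𝓝 A) := by
  set τ := Complex.exp (θ * Complex.I) with hτ
  have hcm : ∀ r : ℝ, circleMap 0 r θ = r * τ := fun r => by simp [circleMap, hτ]
  have hτ1 : ‖τ‖ = 1 := Complex.norm_exp_ofReal_mul_I θ
  -- Any aperture larger than `1` contains the radius.
  have hF : Tendsto f (𝓝[stolzRegion τ 2] τ) (𝓝 A) := by
    have h2 : Tendsto (f ∘ Subtype.val) (comap (Subtype.val : Disc → ℂ) (𝓝[stolzRegion τ 2] τ))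
        (𝓝 A) := (h 2).congr hf
    refine (tendsto_comap'_iff ?_).1 h2
    filter_upwards [self_mem_nhdsWithin] with z hz
    simpa using hz.1
  refine hF.comp (tendsto_nhdsWithin_iff.2 ⟨?_, ?_⟩)
  · have : Continuous fun r : ℝ => circleMap 0 r θ := by
      unfold circleMap
      fun_prop
    have ht := (this.tendsto 1).mono_left (nhdsWithin_le_nhds (s := Set.Iio 1))
    rwa [hcm 1, Complex.ofReal_one, one_mul] at ht
  · filter_upwards [self_mem_nhdsWithin,
      eventually_nhdsWithin_of_eventually_nhds (eventually_gt_nhds one_pos)] with r hr hr0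
    have hr : r < 1 := hr
    have hn : ‖(r : ℂ) * τ‖ = r := by simp [hτ1, abs_of_pos hr0]
    have hs : ‖τ - r * τ‖ = 1 - r := by
      rw [show τ - r * τ = ((1 - r : ℝ) : ℂ) * τ by push_cast; ring, norm_mul, hτ1, mul_one,
        Complex.norm_real, Real.norm_of_nonneg (sub_nonneg.2 hr.le)]
    rw [hcm]
    refine ⟨by rwa [hn], ?_⟩
    rw [hn, hs]
    linarith

theorem norm_onSubspace_le (K : Submodule ℂ U) [K.HasOrthogonalProjection] (X : K →L[ℂ] K) :
    ‖onSubspace K X‖ ≤ ‖X‖ := by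
  refine ContinuousLinearMap.opNorm_le_bound _ X.opNorm_nonneg fun x => ?_
  refine (X.le_opNorm _).trans ?_
  gcongr
  exact K.norm_orthogonalProjectionOnto_apply_le x

variable [CompleteSpace U]

theorem reOp_eq (A : U →L[ℂ] U) : reOp A = (2⁻¹ : ℝ) • (A + star A) := by
  simp [reOp, realPart_apply_coe]

theorem continuous_reOp : Continuous (reOp : (U →L[ℂ] U) → (U →L[ℂ] U)) := by
  simp only [funext reOp_eq]
  fun_prop

theorem norm_reOp_le (A : U →L[ℂ] U) : ‖reOp A‖ ≤ ‖A‖ := by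
  rw [reOp_eq, norm_smul]
  have := norm_add_le A (star A)
  rw [norm_star] at this
  norm_num
  linarith

theorem norm_sqrtRe_mul_self {A : U →L[ℂ] U} (hA : IsPositiveReal A) :
    ‖sqrtRe A‖ * ‖sqrtRe A‖ = ‖reOp A‖ := by
  have hsa : IsSelfAdjoint (sqrtRe A) := IsSelfAdjoint.of_nonneg (CFC.sqrt_nonneg _)
  have h0 : 0 ≤ reOp A := (ContinuousLinearMap.nonneg_iff_isPositive _).2 hA
  rw [← CStarRing.norm_self_mul_star, hsa.star_eq, sqrtRe, CFC.sqrt_mul_sqrt_self _ h0]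

/-- Domination `F ≺ G` bounds the difference by the real part of `G`. -/
theorem Prec.exists_norm_sub_le {F G : Disc → (U →L[ℂ] U)} (hG : ∀ z, IsPositiveReal (G z))
    (h : Prec F G) : ∃ C : ℝ, 0 ≤ C ∧ ∀ z, ‖F z - G z‖ ≤ C * ‖reOp (G z)‖ := by
  obtain ⟨Q, ⟨C, hC⟩, hQ⟩ := h
  have hC0 : 0 ≤ C := (ContinuousLinearMap.opNorm_nonneg _).trans (hC ⟨0, by simp⟩)
  refine ⟨C, hC0, fun z => ?_⟩
  rw [hQ z, ← norm_sqrtRe_mul_self (hG z)]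
  calc _ ≤ ‖sqrtRe (G z)‖ * (‖onSubspace _ (Q z)‖ * ‖sqrtRe (G z)‖) :=
        (ContinuousLinearMap.opNorm_comp_le _ _).trans
          (by gcongr; exact ContinuousLinearMap.opNorm_comp_le _ _)
    _ ≤ ‖sqrtRe (G z)‖ * (C * ‖sqrtRe (G z)‖) := by
        gcongr
        exact (norm_onSubspace_le _ _).trans (hC z)
    _ = _ := by ring

theorem Prec.refl (G : Disc → (U →L[ℂ] U)) : Prec G G :=
  ⟨fun _ => 0, ⟨0, fun _ => ContinuousLinearMap.opNorm_zero.le⟩, fun z => by simp [onSubspace]⟩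

/-- A function dominated by a bounded Carathéodory function whose real part vanishes almost
everywhere on the circle coincides with it. -/
theorem Prec.eq_of_reVanishesAEOnCircle {F G : Disc → (U →L[ℂ] U)} (hF : IsHolomorphic F)
    (hG : G ∈ caratheodoryClass U ∩ hInfty U) (hRe : ReVanishesAEOnCircle G) (h : Prec F G) :
    F = G := by
  obtain ⟨⟨⟨g, hgd, hg⟩, hpos⟩, -, B, hB⟩ := hG
  obtain ⟨f, hfd, hf⟩ := hF
  obtain ⟨C, hC0, hC⟩ := h.exists_norm_sub_le hpos
  have hle : ∀ z ∈ Disc, ‖(f - g) z‖ ≤ C * ‖reOp (g z)‖ := fun z hz => by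
    simpa [hf, hg] using hC ⟨z, hz⟩
  have hbound : ∀ z ∈ Disc, ‖(f - g) z‖ ≤ C * B := fun z hz => by
    refine (hle z hz).trans ?_
    gcongr
    exact (norm_reOp_le _).trans (by simpa [hg] using hB ⟨z, hz⟩)
  have hlim : ∀ᵐ θ : ℝ ∂(volume.restrict (Set.Ioc 0 (2 * Real.pi))),
      Tendsto (fun r : ℝ => (f - g) (circleMap 0 r θ)) (𝓝[<] 1) (𝓝 0) := by
    filter_upwards [hRe] with θ ⟨A, hA, hA0⟩
    have ht := (((continuous_reOp.tendsto A).comp (hA.tendsto_radial hg)).norm).const_mul C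
    rw [hA0, norm_zero, mul_zero] at ht
    refine squeeze_zero_norm' ?_ ht
    filter_upwards [self_mem_nhdsWithin,
      eventually_nhdsWithin_of_eventually_nhds (eventually_gt_nhds one_pos)] with r hr hr0
    exact hle _ (by simpa [abs_of_pos hr0] using hr)
  funext z
  have := eq_zero_of_ae_tendsto_radial_zero (hfd.sub hgd) hbound hlim z.2
  rw [hf, hg]
  exact sub_eq_zero.1 this

end Caratheodory

theorem corollary3p4 {U : Type*} [NormedAddCommGroup U] [InnerProductSpace ℂ U] [CompleteSpace U]
    [FiniteDimensional ℂ U] (G : Caratheodory.Disc → (U →L[ℂ] U))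
    (hG : G ∈ Caratheodory.caratheodoryClass U ∩ Caratheodory.hInfty U)
    (hRe : Caratheodory.ReVanishesAEOnCircle G) :
    {F ∈ Caratheodory.caratheodoryClass U | Caratheodory.Equivalent F G} = {G} ∧
      ∀ F ∈ Caratheodory.caratheodoryClass U, Caratheodory.Prec F G → F = G := by
  have key : ∀ F ∈ Caratheodory.caratheodoryClass U, Caratheodory.Prec F G → F = G :=
    fun F hF h => h.eq_of_reVanishesAEOnCircle hF.1 hG hRe
  refine ⟨Set.eq_singleton_iff_unique_mem.2 ⟨⟨hG.1, ?_, ?_⟩, fun F hF => key F hF.1 hF.2.1⟩, key⟩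
  all_goals exact Caratheodory.Prec.refl G
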